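/- Write $\mathbb{C}[\partial]$ for the polynomial ring; all tensor products are over $\mathbb{C}$, with $\partial$ acting on them by $\partial\otimes 1+1\otimes\partial$. Let $L=\bigoplus_{i\ge 0}\mathbb{C}[\partial]L_i$ be the free $\mathbb{C}[\partial]$-module with the Lie conformal algebra structure determined by $[L_i{}_\lambda L_j]=(2\lambda+\partial)L_{i+j}$. **Definitions.** The conformal dual $L^{*c}$ is the space of $\mathbb{C}$-linear maps $f:L\to\mathbb{C}[\lambda]$ with $f_\lambda(\partial b)=\lambda f_\lambda(b)$; it is a $\mathbb{C}[\partial]$-module through $(\partial f)_\lambda=-\lambda f_\lambda$. For $f,g\in L^{*c}$ and $x,y\in L$ put $[\Phi_\mu(f\otimes g)]_\lambda(x\otimes y)=f_\mu(x)\,g_{\lambda-\mu}(y)$ and $[\pi_\mu(f)]_\lambda(x\otimes y)=f_\lambda([x_\mu y])$. A $\mathbb{C}[\partial]$-submodule $W\subseteq L^{*c}$ is *good* if $\pi_\mu(W)\subseteq\Phi_{-\mu}(W\otimes W)$; its coproduct is then the map $\delta_W:W\to W\otimes W$ with $\Phi_{-\mu}\circ\delta_W=\pi_\mu|_W$. The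 submodule $L^0$ is the sum of all good submodules of $L^{*c}$. A *differential Lie coalgebra* is a $\mathbb{C}[\partial]$-module $C$ with a $\mathbb{C}[\partial]$-homomorphism $\delta:C\to C\otimes C$ such that $\tau\delta=-\delta$ and $(I\otimes\delta)\delta-(\tau\otimes I)(I\otimes\delta)\delta=(\delta\otimes I)\delta$, where $\tau(a\otimes b)=b\otimes a$. A *subcoalgebra* is a $\mathbb{C}[\partial]$-submodule $N$ with $\delta(N)\subseteq N\otimes N$. A $\mathbb{C}[\partial]$-module $N$ has *finite rank* if $N=\bigoplus_{i=1}^n\mathbb{C}[\partial]a_i\oplus\operatorname{Tor}N$ for some finite linearly independent family $(a_i)$. $\operatorname{Loc}(C)$ is the sum of all finite rank subcoalgebras of $C$, and $C$ is *locally finite* if each of its elements lies in a finite rank subcoalgebra. Let $L_j^*\in L^{*c}$ be given by $(L_j^*)_\lambda(L_i)=\delta_{ij}$. For $a\in\mathbb{C}\setminus\{0\}$ and $m\in\mathbb{Z}_{\ge 0}$ let $f_{a,m}\in L^{*c}$ be given by $(f_{a,m})_\lambda(L_i)=a^i i^m$ (with $0^0=1$). Let $V$ and $U$ be the $\mathbb{C}[\partial]$-submodules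 of $L^{*c}$ spanned by all $L_j^*$ and by all $f_{a,m}$, respectively. An element $f\in L^{*c}$ is a *linearly conformal recursive sequence* if there are $N,r\in\mathbb{Z}_{\ge 0}$ and $\beta_0,\dots,\beta_r\in\mathbb{C}$, not all zero, such that $\sum_{s=0}^r\beta_s f_\lambda(L_{n+s})=0$ for all $n\ge N$. **Theorem.** (a) $U$ is good. Its coproduct $\delta_U$ exists, is unique, makes $U$ a differential Lie coalgebra, and satisfies, for all $a\ne 0$ and $m\ge 0$, $$\delta_U(f_{a,m})=\sum_{j=0}^m\binom mj\bigl(\partial f_{a,j}\otimes f_{a,m-j}-f_{a,j}\otimes\partial f_{a,m-j}\bigr).$$ (b) The family consisting of the $f_{a,m}$ ($a\in\mathbb{C}\setminus\{0\}$, $m\ge 0$) and the $L_i^*$ ($i\ge 0$) is linearly independent over $\mathbb{C}[\partial]$, and its $\mathbb{C}[\partial]$-span is the set of all linearly conformal recursive sequences; that is, it is a $\mathbb{C}[\partial]$-basis of the space of these sequences. (c) $V\cap U=0$, and $L^0=V\oplus U$ is equal to the space of linearly conformal recursive sequences. (d) For each $a\in\mathbb{C}\setminus\{0\}$ and $m\ge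 0$, $\bigoplus_{j=0}^m\mathbb{C}[\partial]f_{a,j}$ is a finite rank subcoalgebra of $U$. (e) The coproduct of $L^0$ exists, is unique and makes $L^0$ a differential Lie coalgebra, and $\operatorname{Loc}(L^0)=V\oplus U=L^0$. In particular, $L^0$ is locally finite. -/

import Mathlib

open Polynomial TensorProduct

noncomputable section

/-! ### Lie conformal algebras

`ℂ[∂]` is `ℂ[X]`, and a `ℂ[∂]`-module is a complex vector space with a compatible `ℂ[X]`-action,
`∂` acting as `X`.  All tensor products are over `ℂ`. -/

section General

variable {M : Type*} [AddCommGroup M] [Module ℂ M] [Module ℂ[X] M] [IsScalarTower ℂ ℂ[X] M]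

/-- The action of `∂` as a `ℂ`-linear map. -/
def partialEnd (M : Type*) [AddCommGroup M] [Module ℂ M] [Module ℂ[X] M]
    [IsScalarTower ℂ ℂ[X] M] : M →ₗ[ℂ] M :=
  Algebra.lsmul ℂ ℂ M (X : ℂ[X])

/-- The diagonal action `∂ ⊗ 1 + 1 ⊗ ∂` of `∂` on `M ⊗ M`. -/
def partialTensor (M : Type*) [AddCommGroup M] [Module ℂ M] [Module ℂ[X] M]
    [IsScalarTower ℂ ℂ[X] M] : M ⊗[ℂ] M →ₗ[ℂ] M ⊗[ℂ] M :=
  TensorProduct.map (partialEnd M) LinearMap.id + TensorProduct.map LinearMap.id (partialEnd M)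

/-- Substitution `λ ↦ q(∂)` in an element of `ℂ[λ] ⊗ M`, the powers of `q(∂)` acting on the
coefficients: `p(λ) ⊗ m ↦ p(q(∂)) m`.  For a constant `q = z` this is the value at `λ = z`. -/
def substLambda (q : ℂ[X]) : ℂ[X] ⊗[ℂ] M →ₗ[ℂ] M :=
  TensorProduct.lift ((Algebra.lsmul ℂ ℂ M).toLinearMap ∘ₗ (aeval q : ℂ[X] →ₐ[ℂ] ℂ[X]).toLinearMap)

end General

/-- A Lie conformal algebra structure on the `ℂ[∂]`-module `L`: a `λ`-bracket
`L ⊗ L → ℂ[λ] ⊗ L`.  The axioms are identities between polynomials in `λ` (and `μ`) with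
coefficients in `L`; they are stated as identities between the values at all `λ = z`, `μ = w` in
the infinite field `ℂ`, which is the same thing. -/
class LieConformalAlgebra (L : Type*) [AddCommGroup L] [Module ℂ L] [Module ℂ[X] L]
    [IsScalarTower ℂ ℂ[X] L] where
  bracket : L →ₗ[ℂ] L →ₗ[ℂ] ℂ[X] ⊗[ℂ] L
  sesquilinear_left : ∀ (z : ℂ) (a b : L),
    substLambda (C z) (bracket ((X : ℂ[X]) • a) b) = -(z • substLambda (C z) (bracket a b))
  sesquilinear_right : ∀ (z : ℂ) (a b : L),
    substLambda (C z) (bracket a ((X : ℂ[X]) • b)) =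
      (C z + X : ℂ[X]) • substLambda (C z) (bracket a b)
  skew : ∀ (z : ℂ) (a b : L),
    substLambda (C z) (bracket a b) = -substLambda (-C z - X) (bracket b a)
  jacobi : ∀ (z w : ℂ) (a b c : L),
    substLambda (C z) (bracket a (substLambda (C w) (bracket b c))) =
      substLambda (C (z + w)) (bracket (substLambda (C z) (bracket a b)) c) +
        substLambda (C w) (bracket b (substLambda (C z) (bracket a c)))

/-! ### The conformal dual -/

/-- The conformal dual of `M` as a complex vector space: the `ℂ`-linear maps `f : M → ℂ[λ]` with
`f_λ(∂ b) = λ f_λ(b)`. -/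
def conformalDualSubmodule (M : Type*) [AddCommGroup M] [Module ℂ M] [Module ℂ[X] M] :
    Submodule ℂ (M →ₗ[ℂ] ℂ[X]) where
  carrier := {f | ∀ b : M, f ((X : ℂ[X]) • b) = X * f b}
  add_mem' := by
    intro f g hf hg b
    simp only [Set.mem_ofPred_eq] at hf hg
    simp [hf b, hg b, mul_add]
  zero_mem' := by intro b; simp
  smul_mem' := by
    intro c f hf b
    simp only [Set.mem_ofPred_eq] at hf
    simp [hf b]

/-- The conformal dual of `M`. -/
def ConformalDual (M : Type*) [AddCommGroup M] [Module ℂ M] [Module ℂ[X] M] : Type _ :=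
  conformalDualSubmodule M

namespace ConformalDual

variable {M : Type*} [AddCommGroup M] [Module ℂ M] [Module ℂ[X] M]

instance : AddCommGroup (ConformalDual M) :=
  inferInstanceAs (AddCommGroup (conformalDualSubmodule M))

instance : Module ℂ (ConformalDual M) :=
  inferInstanceAs (Module ℂ (conformalDualSubmodule M))

/-- The underlying linear map `b ↦ f_λ(b)`. -/
def toLin : ConformalDual M →ₗ[ℂ] (M →ₗ[ℂ] ℂ[X]) := (conformalDualSubmodule M).subtype

/-- The action of `∂` on the conformal dual: `(∂ f)_λ = -λ f_λ`. -/
def partialDual : Module.End ℂ (ConformalDual M) :=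
  LinearMap.restrict (p := conformalDualSubmodule M) (q := conformalDualSubmodule M)
    (LinearMap.compRight ℂ (-LinearMap.mulLeft ℂ (X : ℂ[X])))
    (by
      intro f hf b
      have h := hf b
      simp [h])

/-- The `ℂ[∂]`-module structure determined by `partialDual`. -/
instance : Module ℂ[X] (ConformalDual M) :=
  Module.compHom (ConformalDual M) (aeval (partialDual (M := M))).toRingHom

theorem smul_def (p : ℂ[X]) (f : ConformalDual M) : p • f = aeval (partialDual (M := M)) p f := rfl

instance : IsScalarTower ℂ ℂ[X] (ConformalDual M) :=
  ⟨fun c p f => by simp [smul_def]⟩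

theorem X_smul (f : ConformalDual M) (b : M) :
    toLin ((X : ℂ[X]) • f) b = -(X * toLin f b) := by
  simp only [smul_def, aeval_X]
  rfl

end ConformalDual

/-! ### Differential Lie coalgebras -/

section Coalgebra

variable {C : Type*} [AddCommGroup C] [Module ℂ C] [Module ℂ[X] C] [IsScalarTower ℂ ℂ[X] C]

/-- `δ : C → C ⊗ C` is the coproduct of a differential Lie coalgebra: it is `ℂ[∂]`-linear,
co-skew-symmetric and satisfies the co-Jacobi identity
`(I ⊗ δ) δ - (τ ⊗ I) (I ⊗ δ) δ = (δ ⊗ I) δ` in `C ⊗ (C ⊗ C)`. -/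
structure IsDifferentialLieCoalgebra (δ : C →ₗ[ℂ] C ⊗[ℂ] C) : Prop where
  map_partial : ∀ c : C, δ ((X : ℂ[X]) • c) = partialTensor C (δ c)
  coskew : ∀ c : C, TensorProduct.comm ℂ C C (δ c) = -δ c
  cojacobi : ∀ c : C,
    δ.lTensor C (δ c) - TensorProduct.leftComm ℂ C C C (δ.lTensor C (δ c)) =
      TensorProduct.assoc ℂ C C C (δ.rTensor C (δ c))

/-- The inclusion `N ⊗ N → C ⊗ C` for a `ℂ[∂]`-submodule `N` of `C`. -/
def tensorIncl (N : Submodule ℂ[X] C) : N ⊗[ℂ] N →ₗ[ℂ] C ⊗[ℂ] C :=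
  TensorProduct.map (N.subtype.restrictScalars ℂ) (N.subtype.restrictScalars ℂ)

/-- `N` is a subcoalgebra: `δ(N) ⊆ N ⊗ N`. -/
def IsSubcoalgebra (δ : C →ₗ[ℂ] C ⊗[ℂ] C) (N : Submodule ℂ[X] C) : Prop :=
  ∀ x ∈ N, δ x ∈ LinearMap.range (tensorIncl N)

/-- A `ℂ[∂]`-module of finite rank: `M = ⨁ᵢ ℂ[∂] aᵢ ⊕ Tor M` with finitely many free
generators `aᵢ`. -/
def IsFiniteRank (M : Type*) [AddCommGroup M] [Module ℂ[X] M] : Prop :=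
  ∃ (n : ℕ) (a : Fin n → M), LinearIndependent ℂ[X] a ∧
    IsCompl (Submodule.span ℂ[X] (Set.range a)) (Submodule.torsion ℂ[X] M)

/-- `Loc`: the sum of all subcoalgebras of finite rank. -/
def Loc (δ : C →ₗ[ℂ] C ⊗[ℂ] C) : Submodule ℂ[X] C :=
  sSup {N | IsSubcoalgebra δ N ∧ IsFiniteRank N}

/-- Locally finite: every element lies in a subcoalgebra of finite rank. -/
def IsLocallyFinite (δ : C →ₗ[ℂ] C ⊗[ℂ] C) : Prop :=
  ∀ x : C, ∃ N : Submodule ℂ[X] C, IsSubcoalgebra δ N ∧ IsFiniteRank N ∧ x ∈ N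

end Coalgebra

/-! ### Good submodules and the upper zero of a Lie conformal algebra

An element of `ℂ[μ] ⊗ (L ⊗ L)^{*c}` is recorded by its values at all `μ = w` in `ℂ`, each of which
is a map `L ⊗ L → ℂ[λ]`. -/

section Good

variable {L : Type*} [AddCommGroup L] [Module ℂ L] [Module ℂ[X] L] [IsScalarTower ℂ ℂ[X] L]

/-- `[Φ_w(f ⊗ g)]_λ (r ⊗ r') = f_w(r) g_{λ - w}(r')`. -/
def Phi (w : ℂ) : ConformalDual L ⊗[ℂ] ConformalDual L →ₗ[ℂ] (L ⊗[ℂ] L →ₗ[ℂ] ℂ[X]) :=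
  LinearMap.compRight ℂ (LinearMap.mul' ℂ ℂ[X]) ∘ₗ
    TensorProduct.homTensorHomMap (RingHom.id ℂ) L L ℂ[X] ℂ[X] ∘ₗ
      TensorProduct.map
        (LinearMap.compRight ℂ (aeval (C w) : ℂ[X] →ₐ[ℂ] ℂ[X]).toLinearMap ∘ₗ
          ConformalDual.toLin)
        (LinearMap.compRight ℂ (aeval (X - C w) : ℂ[X] →ₐ[ℂ] ℂ[X]).toLinearMap ∘ₗ
          ConformalDual.toLin)

theorem Phi_tmul (w : ℂ) (f g : ConformalDual L) (r r' : L) :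
    Phi w (f ⊗ₜ g) (r ⊗ₜ r') = C ((f.toLin r).eval w) * (g.toLin r').comp (X - C w) := by
  simp only [Phi, LinearMap.comp_apply, TensorProduct.map_tmul,
    TensorProduct.homTensorHomMap_apply, LinearMap.compRight_apply, LinearMap.mul'_apply,
    AlgHom.toLinearMap_apply]
  rw [← comp_eq_aeval, ← comp_eq_aeval, comp_C]

variable [LieConformalAlgebra L]

/-- `[π_w(f)]_λ (a ⊗ b) = f_λ([a_w b])`. -/
def piMap (w : ℂ) (f : ConformalDual L) : L ⊗[ℂ] L →ₗ[ℂ] ℂ[X] :=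
  f.toLin ∘ₗ substLambda (C w) ∘ₗ TensorProduct.lift LieConformalAlgebra.bracket

/-- `V` is good: `π_μ(V) ⊆ Φ_{-μ}(V ⊗ V)`. -/
def IsGood (V : Submodule ℂ[X] (ConformalDual L)) : Prop :=
  ∀ f ∈ V, ∃ t ∈ LinearMap.range (tensorIncl V), ∀ w : ℂ, piMap w f = Phi (-w) t

/-- `δ : V → V ⊗ V` is the map `δ_V` of the good submodule `V`: `Φ_{-μ} ∘ δ = π_μ` on `V`. -/
def IsCoproductOf (V : Submodule ℂ[X] (ConformalDual L)) (δ : V →ₗ[ℂ] V ⊗[ℂ] V) : Prop :=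
  ∀ (f : V) (w : ℂ), Phi (-w) (tensorIncl V (δ f)) = piMap w (f : ConformalDual L)

/-- The upper zero `L⁰`: the sum of all good submodules of the conformal dual. -/
def upperZero (L : Type*) [AddCommGroup L] [Module ℂ L] [Module ℂ[X] L]
    [IsScalarTower ℂ ℂ[X] L] [LieConformalAlgebra L] : Submodule ℂ[X] (ConformalDual L) :=
  sSup {V | IsGood V}

end Good

/-! ### The Witt-type Lie conformal algebra -/

/-- The free `ℂ[∂]`-module `⨁_{i ≥ 0} ℂ[∂] L_i`. -/
abbrev Witt : Type := ℕ →₀ ℂ[X]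

namespace Witt

/-- The generator `L_i`. -/
def gen (i : ℕ) : Witt := Finsupp.single i 1

/-- `p(-λ) q(λ + ∂) (2 λ + ∂)` in `ℂ[λ] ⊗ ℂ[∂]`, bilinear in `p` and `q`. -/
def coeff : ℂ[X] →ₗ[ℂ] ℂ[X] →ₗ[ℂ] ℂ[X] ⊗[ℂ] ℂ[X] :=
  ((LinearMap.mul ℂ (ℂ[X] ⊗[ℂ] ℂ[X])).compl₁₂
    (aeval (-((X : ℂ[X]) ⊗ₜ[ℂ] (1 : ℂ[X])))).toLinearMap
    (aeval ((X : ℂ[X]) ⊗ₜ[ℂ] (1 : ℂ[X]) + (1 : ℂ[X]) ⊗ₜ[ℂ] (X : ℂ[X]))).toLinearMap).compr₂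
    (LinearMap.mulRight ℂ (2 * ((X : ℂ[X]) ⊗ₜ[ℂ] (1 : ℂ[X])) + (1 : ℂ[X]) ⊗ₜ[ℂ] (X : ℂ[X])))

/-- The `λ`-bracket, determined by
`[p(∂) L_i _λ q(∂) L_j] = p(-λ) q(λ + ∂) (2 λ + ∂) L_{i+j}`. -/
def bracket : Witt →ₗ[ℂ] Witt →ₗ[ℂ] ℂ[X] ⊗[ℂ] Witt :=
  Finsupp.lsum ℂ fun i => LinearMap.flip <| Finsupp.lsum ℂ fun j => LinearMap.flip <|
    coeff.compr₂ (LinearMap.lTensor ℂ[X] (Finsupp.lsingle (M := ℂ[X]) (R := ℂ) (i + j)))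

theorem bracket_single (i j : ℕ) (p q : ℂ[X]) :
    bracket (Finsupp.single i p) (Finsupp.single j q) =
      LinearMap.lTensor ℂ[X] (Finsupp.lsingle (M := ℂ[X]) (R := ℂ) (i + j)) (coeff p q) := by
  simp [bracket]

theorem subst_lTensor (q : ℂ[X]) (k : ℕ) (t : ℂ[X] ⊗[ℂ] ℂ[X]) :
    substLambda q (LinearMap.lTensor ℂ[X] (Finsupp.lsingle (M := ℂ[X]) (R := ℂ) k) t) =
      Finsupp.single k
        (Algebra.TensorProduct.productMap (aeval q : ℂ[X] →ₐ[ℂ] ℂ[X]) (AlgHom.id ℂ ℂ[X]) t) := by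
  induction t with
  | zero => simp
  | add x y hx hy => simp only [map_add, hx, hy, Finsupp.single_add]
  | tmul x y => simp [substLambda]

theorem subst_bracket_single (s : ℂ[X]) (i j : ℕ) (p q : ℂ[X]) :
    substLambda s (bracket (Finsupp.single i p) (Finsupp.single j q)) =
      Finsupp.single (i + j) (p.comp (-s) * q.comp (s + X) * (2 * s + X)) := by
  rw [bracket_single, subst_lTensor]
  congr 1
  simp only [coeff, LinearMap.compr₂_apply, LinearMap.compl₁₂_apply, AlgHom.toLinearMap_apply,
    LinearMap.mul_apply', LinearMap.mulRight_apply, map_mul, map_add, map_ofNat, ← aeval_algHom_apply]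
  simp [← comp_eq_aeval]

instance : LieConformalAlgebra Witt where
  bracket := bracket
  sesquilinear_left := by
    intro z a b
    induction a using Finsupp.induction_linear with
    | zero => simp
    | add a a' ha ha' => simp only [smul_add, map_add, LinearMap.add_apply, ha, ha', neg_add]
    | single i p =>
      induction b using Finsupp.induction_linear with
      | zero => simp
      | add b b' hb hb' => simp only [smul_add, map_add, hb, hb', neg_add]
      | single j q =>
        rw [Finsupp.smul_single, subst_bracket_single, subst_bracket_single, Finsupp.smul_single,
          ← Finsupp.single_neg]
        congr 1
        simp only [smul_eq_mul, mul_comp, X_comp, smul_eq_C_mul]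
        ring
  sesquilinear_right := by
    intro z a b
    induction a using Finsupp.induction_linear with
    | zero => simp
    | add a a' ha ha' => simp only [smul_add, map_add, LinearMap.add_apply, ha, ha']
    | single i p =>
      induction b using Finsupp.induction_linear with
      | zero => simp
      | add b b' hb hb' => simp only [smul_add, map_add, hb, hb']
      | single j q =>
        rw [Finsupp.smul_single, subst_bracket_single, subst_bracket_single, Finsupp.smul_single]
        congr 1
        simp only [smul_eq_mul, mul_comp, X_comp]
        ring
  skew := by
    intro z a b
    induction a using Finsupp.induction_linear with
    | zero => simp
    | add a a' ha ha' => simp only [map_add, LinearMap.add_apply, ha, ha', neg_add]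
    | single i p =>
      induction b using Finsupp.induction_linear with
      | zero => simp
      | add b b' hb hb' => simp only [map_add, LinearMap.add_apply, hb, hb', neg_add]
      | single j q =>
        rw [subst_bracket_single, subst_bracket_single, ← Finsupp.single_neg, add_comm j i]
        congr 1
        rw [show (-(-C z - X) : ℂ[X]) = C z + X by ring, show (-C z - X + X : ℂ[X]) = -C z by ring]
        ring
  jacobi := by
    intro z w a b c
    induction a using Finsupp.induction_linear with
    | zero => simp
    | add a a' ha ha' => simp only [map_add, LinearMap.add_apply, ha, ha']; abel
    | single i p =>
      induction b using Finsupp.induction_linear with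
      | zero => simp
      | add b b' hb hb' => simp only [map_add, LinearMap.add_apply, hb, hb']; abel
      | single j q =>
        induction c using Finsupp.induction_linear with
        | zero => simp
        | add c c' hc hc' => simp only [map_add, hc, hc']; abel
        | single k r =>
          simp only [subst_bracket_single]
          rw [show j + (i + k) = i + (j + k) by ring, show i + j + k = i + (j + k) by ring,
            ← Finsupp.single_add]
          congr 1
          simp only [mul_comp, add_comp, X_comp, C_comp, comp_assoc, neg_comp, map_add,
            ofNat_comp]
          rw [show (C z + -(C z + C w) : ℂ[X]) = -C w by ring,
            show (C w + (C z + X) : ℂ[X]) = C z + C w + X by ring,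
            show (C z + (C w + X) : ℂ[X]) = C z + C w + X by ring, ← C_neg, ← C_neg]
          simp only [comp_C]
          ring

/-- `[L_i _λ L_j] = (2 λ + ∂) L_{i+j}`. -/
theorem bracket_gen (i j : ℕ) :
    LieConformalAlgebra.bracket (gen i) (gen j) =
      (2 * X : ℂ[X]) ⊗ₜ[ℂ] gen (i + j) + (1 : ℂ[X]) ⊗ₜ[ℂ] ((X : ℂ[X]) • gen (i + j)) := by
  change bracket _ _ = _
  rw [gen, gen, bracket_single]
  have h2 : (2 : ℂ[X] ⊗[ℂ] ℂ[X]) = (2 : ℂ[X]) ⊗ₜ[ℂ] (1 : ℂ[X]) := rfl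
  simp [coeff, gen, h2]

/-- The element of the conformal dual with prescribed values `f_λ(L_i) = s i`, that is
`f_λ(∑ pᵢ(∂) L_i) = ∑ pᵢ(λ) s i`. -/
def dualOf (s : ℕ → ℂ[X]) : ConformalDual Witt :=
  ⟨(Finsupp.linearCombination ℂ[X] s).restrictScalars ℂ, fun b => by simp⟩

theorem dualOf_gen (s : ℕ → ℂ[X]) (i : ℕ) : (dualOf s).toLin (gen i) = s i := by
  change Finsupp.linearCombination ℂ[X] s (gen i) = s i
  simp [gen]

/-- `L_j^*`: the element with `(L_j^*)_λ(p(∂) L_i) = δ_{ij} p(λ)`. -/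
def genDual (j : ℕ) : ConformalDual Witt := dualOf (Pi.single j 1)

/-- `f_{a,m} = ∑ aⁱ iᵐ L_i^*` for `a ≠ 0` and `m ≥ 0` (with `0⁰ = 1`). -/
def fam (a : ℂˣ) (m : ℕ) : ConformalDual Witt := dualOf fun i => C ((a : ℂ) ^ i * (i : ℂ) ^ m)

/-- `V = ∑ ℂ[∂] L_i^*`. -/
def V : Submodule ℂ[X] (ConformalDual Witt) := Submodule.span ℂ[X] (Set.range genDual)

/-- `U = ∑ ℂ[∂] f_{a,m}`. -/
def U : Submodule ℂ[X] (ConformalDual Witt) :=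
  Submodule.span ℂ[X] (Set.range fun x : ℂˣ × ℕ => fam x.1 x.2)

/-- `f_{a,m}` as an element of `U`. -/
def famU (a : ℂˣ) (m : ℕ) : U := ⟨fam a m, Submodule.subset_span ⟨(a, m), rfl⟩⟩

/-- Linearly conformal recursive sequences: `∑_{s=0}^r β_s f_λ(L_{n+s}) = 0` for all `n ≥ N`, with
constants `β_s ∈ ℂ` that are not all zero. -/
def IsRecursive (f : ConformalDual Witt) : Prop :=
  ∃ (N r : ℕ) (β : ℕ → ℂ), (∃ s ≤ r, β s ≠ 0) ∧
    ∀ n ≥ N, ∑ s ∈ Finset.range (r + 1), β s • f.toLin (gen (n + s)) = 0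

end Witt

end

/-! An element `f` of the conformal dual is the sequence of polynomials `f_λ(L_i)`. The functionals
`coord (i, x) : f ↦ f_x(L_i)` separate points, and their products separate points of tensor products
(`eq_zero_of_tensorEval`). By `piMap_eq_Phi_iff`, `t` is a cobracket of `f` exactly when the product
of `coord (i, x)` and `coord (j, y)` sends `t` to `(y - x) f_{x+y}(L_{i+j})`. Hence cobrackets are
unique, and linearity of the coproduct, co-skew-symmetry and co-Jacobi become scalar identities.

`V` and `U` are good by explicit cobrackets; for `U` the formula is the binomial expansion of `(i +
j)^m`. Conversely, a cobracket with `n` summands, evaluated at `x = 0`, bounds the rank of the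
Hankel matrix `y f_y(L_{i+j})` by `n`, which forces a recursion with constant coefficients
(`isGood_le_recursive`). Being recursive means being killed by a nonzero complex polynomial in the
shift `E`. Such a polynomial splits, and `V + U` contains `ker (E - b)` and lies in its own image
under `E - b` for every `b`, so `V + U` contains all recursive sequences (`recursive_eq`).

Linear independence, and with it `V ∩ U = 0`, comes from the independence of the generalized
eigenspaces of `E`. Local finiteness holds because initial segments of the families `f_{a,j}` and
`L_j^*` span finitely generated good submodules. -/

noncomputable section

/-! ### Separating functionals on tensor products -/

section TensorEval

variable {M N P : Type*} [AddCommGroup M] [Module ℂ M] [AddCommGroup N] [Module ℂ N]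
  [AddCommGroup P] [Module ℂ P]

/-- The functional `m ⊗ n ↦ φ m * ψ n`. -/
def tensorEval (φ : M →ₗ[ℂ] ℂ) (ψ : N →ₗ[ℂ] ℂ) : M ⊗[ℂ] N →ₗ[ℂ] ℂ :=
  LinearMap.mul' ℂ ℂ ∘ₗ TensorProduct.map φ ψ

@[simp]
theorem tensorEval_tmul (φ : M →ₗ[ℂ] ℂ) (ψ : N →ₗ[ℂ] ℂ) (m : M) (n : N) :
    tensorEval φ ψ (m ⊗ₜ n) = φ m * ψ n := by
  simp [tensorEval]

theorem tensorEval_lTensor (φ : M →ₗ[ℂ] ℂ) (ψ : P →ₗ[ℂ] ℂ) (δ : N →ₗ[ℂ] P) (t : M ⊗[ℂ] N) :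
    tensorEval φ ψ (δ.lTensor M t) = tensorEval φ (ψ ∘ₗ δ) t := by
  induction t with
  | zero => simp
  | add s t hs ht => simp only [map_add, hs, ht]
  | tmul m n => simp

theorem tensorEval_rTensor (φ : P →ₗ[ℂ] ℂ) (ψ : N →ₗ[ℂ] ℂ) (δ : M →ₗ[ℂ] P) (t : M ⊗[ℂ] N) :
    tensorEval φ ψ (δ.rTensor N t) = tensorEval (φ ∘ₗ δ) ψ t := by
  induction t with
  | zero => simp
  | add s t hs ht => simp only [map_add, hs, ht]
  | tmul m n => simp

theorem tensorEval_comm (φ : N →ₗ[ℂ] ℂ) (ψ : M →ₗ[ℂ] ℂ) (t : M ⊗[ℂ] N) :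
    tensorEval φ ψ (TensorProduct.comm ℂ M N t) = tensorEval ψ φ t := by
  induction t with
  | zero => simp
  | add s t hs ht => simp only [map_add, hs, ht]
  | tmul m n => simp [mul_comm]

theorem tensorEval_leftComm (φ : N →ₗ[ℂ] ℂ) (ψ : M →ₗ[ℂ] ℂ) (χ : P →ₗ[ℂ] ℂ)
    (t : M ⊗[ℂ] (N ⊗[ℂ] P)) :
    tensorEval φ (tensorEval ψ χ) (TensorProduct.leftComm ℂ M N P t) =
      tensorEval ψ (tensorEval φ χ) t := by
  induction t with
  | zero => simp
  | add s t hs ht => simp only [map_add, hs, ht]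
  | tmul m u =>
    induction u with
    | zero => simp
    | add s t hs ht => simp only [TensorProduct.tmul_add, map_add, hs, ht]
    | tmul n p => simp; ring

theorem tensorEval_assoc (φ : M →ₗ[ℂ] ℂ) (ψ : N →ₗ[ℂ] ℂ) (χ : P →ₗ[ℂ] ℂ)
    (t : (M ⊗[ℂ] N) ⊗[ℂ] P) :
    tensorEval φ (tensorEval ψ χ) (TensorProduct.assoc ℂ M N P t) =
      tensorEval (tensorEval φ ψ) χ t := by
  induction t with
  | zero => simp
  | add s t hs ht => simp only [map_add, hs, ht]
  | tmul u p =>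
    induction u with
    | zero => simp
    | add s t hs ht => simp only [TensorProduct.add_tmul, map_add, hs, ht]
    | tmul m n => simp; ring

theorem tensorEval_smul_left (c : ℂ) (φ : M →ₗ[ℂ] ℂ) (ψ : N →ₗ[ℂ] ℂ) (t : M ⊗[ℂ] N) :
    tensorEval (c • φ) ψ t = c * tensorEval φ ψ t := by
  simp [tensorEval, TensorProduct.map_smul_left]

theorem tensorEval_smul_right (c : ℂ) (φ : M →ₗ[ℂ] ℂ) (ψ : N →ₗ[ℂ] ℂ) (t : M ⊗[ℂ] N) :
    tensorEval φ (c • ψ) t = c * tensorEval φ ψ t := by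
  simp [tensorEval, TensorProduct.map_smul_right]

/-- If `φ` and `ψ` are separating families of functionals, then so is `φ ⊗ ψ`. -/
theorem eq_zero_of_tensorEval {α β : Type*} {φ : α → M →ₗ[ℂ] ℂ} {ψ : β → N →ₗ[ℂ] ℂ}
    (hφ : ∀ m, (∀ a, φ a m = 0) → m = 0) (hψ : ∀ n, (∀ b, ψ b n = 0) → n = 0)
    {t : M ⊗[ℂ] N} (h : ∀ a b, tensorEval (φ a) (ψ b) t = 0) : t = 0 := by
  classical
  let B := Module.Basis.ofVectorSpace ℂ N
  -- Contracting the left factor with `φ a` gives an element of `N` killed by every `ψ b`. The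
  -- coefficients of `t` along a basis of `N` are then killed by every `φ a`.
  have key : ∀ a, (TensorProduct.lid ℂ N) ((φ a).rTensor N t) = 0 := fun a => hψ _ fun b => by
    rw [← h a b]
    clear h
    induction t with
    | zero => simp
    | add s t hs ht => simp only [map_add, hs, ht]
    | tmul m n => simp
  apply (TensorProduct.equivFinsuppOfBasisRight (M := M) B).injective
  rw [map_zero]
  ext k
  refine hφ _ fun a => ?_
  have h2 := congrArg (fun n => B.repr n k) (key a)
  simp only [map_zero, Finsupp.zero_apply] at h2
  rw [← h2]
  clear h h2 key
  induction t with
  | zero => simp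
  | add s t hs ht => simp only [map_add, Finsupp.add_apply, hs, ht]
  | tmul m n => simp [mul_comm]

theorem eq_of_tensorEval {α β : Type*} {φ : α → M →ₗ[ℂ] ℂ} {ψ : β → N →ₗ[ℂ] ℂ}
    (hφ : ∀ m, (∀ a, φ a m = 0) → m = 0) (hψ : ∀ n, (∀ b, ψ b n = 0) → n = 0)
    {s t : M ⊗[ℂ] N} (h : ∀ a b, tensorEval (φ a) (ψ b) s = tensorEval (φ a) (ψ b) t) :
    s = t :=
  sub_eq_zero.1 <| eq_zero_of_tensorEval hφ hψ fun a b => by rw [map_sub, h, sub_self]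

end TensorEval

/-! ### Coordinates on the conformal dual -/

namespace Witt

/-- The polynomial `f_λ(L_i)`. -/
def seq (i : ℕ) : ConformalDual Witt →ₗ[ℂ] ℂ[X] := LinearMap.applyₗ (gen i) ∘ₗ ConformalDual.toLin

theorem seq_apply (i : ℕ) (f : ConformalDual Witt) : seq i f = f.toLin (gen i) := rfl

theorem toLin_smul {M : Type*} [AddCommGroup M] [Module ℂ M] [Module ℂ[X] M]
    [IsScalarTower ℂ ℂ[X] M] (f : ConformalDual M) (p : ℂ[X]) (b : M) :
    f.toLin (p • b) = p * f.toLin b := by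
  have hX : ∀ b : M, f.toLin ((X : ℂ[X]) • b) = X * f.toLin b := f.2
  induction p using Polynomial.induction_on' with
  | add p q hp hq => rw [add_smul, map_add, hp, hq, add_mul]
  | monomial n c =>
    induction n generalizing b with
    | zero =>
      rw [monomial_zero_left, ← smul_eq_C_mul, ← algebraMap_eq, algebraMap_smul, map_smul]
    | succ n ih => rw [← monomial_mul_X, mul_smul, ih, hX, mul_assoc]

theorem toLin_single (f : ConformalDual Witt) (i : ℕ) (p : ℂ[X]) :
    f.toLin (Finsupp.single i p) = p * seq i f := by
  rw [seq_apply, ← toLin_smul, gen, Finsupp.smul_single, smul_eq_mul, mul_one]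

theorem ext_seq {f g : ConformalDual Witt} (h : ∀ i, seq i f = seq i g) : f = g := by
  apply Subtype.ext
  change f.toLin = g.toLin
  refine LinearMap.ext fun b => ?_
  induction b using Finsupp.induction_linear with
  | zero => simp
  | add b c hb hc => simp only [map_add, hb, hc]
  | single i p => rw [toLin_single, toLin_single, h]

theorem seq_dualOf (s : ℕ → ℂ[X]) (i : ℕ) : seq i (dualOf s) = s i := dualOf_gen s i

theorem seq_genDual (i j : ℕ) : seq i (genDual j) = if i = j then 1 else 0 := by
  rw [genDual, seq_dualOf, Pi.single_apply]

theorem seq_fam (i : ℕ) (a : ℂˣ) (m : ℕ) : seq i (fam a m) = C ((a : ℂ) ^ i * (i : ℂ) ^ m) :=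
  seq_dualOf _ i

theorem seq_smul (p : ℂ[X]) (f : ConformalDual Witt) (i : ℕ) :
    seq i (p • f) = p.comp (-X) * seq i f := by
  induction p using Polynomial.induction_on' with
  | add p q hp hq => rw [add_smul, map_add, hp, hq, add_comp, add_mul]
  | monomial n c =>
    induction n generalizing f with
    | zero =>
      rw [monomial_zero_left, C_comp, ← smul_eq_C_mul, ← algebraMap_eq, algebraMap_smul, map_smul]
    | succ n ih =>
      rw [← monomial_mul_X, mul_smul, ih, seq_apply, ConformalDual.X_smul, mul_comp, X_comp,
        seq_apply]
      ring

/-- `p(∂)` multiplies every value by `p(-λ)`, which is nonzero in the domain `ℂ[λ]` when `p ≠ 0`. -/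
instance : Module.IsTorsionFree ℂ[X] (ConformalDual Witt) := by
  refine .of_smul_eq_zero fun p f h => ?_
  by_contra! H
  obtain ⟨hp, hf⟩ := H
  apply hf
  apply ext_seq
  intro i
  have := seq_smul p f i
  rw [h, map_zero] at this
  rw [map_zero]
  refine (mul_eq_zero.1 this.symm).resolve_left fun h0 => hp ?_
  have := congrArg (fun q : ℂ[X] => q.comp (-X)) h0
  simpa [comp_assoc] using this

/-- The functional `f ↦ f_x(L_i)`. -/
def coord (p : ℕ × ℂ) : ConformalDual Witt →ₗ[ℂ] ℂ := Polynomial.leval p.2 ∘ₗ seq p.1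

@[simp]
theorem coord_apply (i : ℕ) (x : ℂ) (f : ConformalDual Witt) :
    coord (i, x) f = (seq i f).eval x := rfl

theorem eq_zero_of_coord (f : ConformalDual Witt) (h : ∀ p, coord p f = 0) : f = 0 :=
  ext_seq fun i => Polynomial.funext fun x => by simpa using h (i, x)

/-- The restriction of `coord` to a submodule. -/
def coordOn (S : Submodule ℂ[X] (ConformalDual Witt)) (p : ℕ × ℂ) : S →ₗ[ℂ] ℂ :=
  coord p ∘ₗ S.subtype.restrictScalars ℂ

@[simp]
theorem coordOn_apply (S : Submodule ℂ[X] (ConformalDual Witt)) (i : ℕ) (x : ℂ) (f : S) :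
    coordOn S (i, x) f = (seq i (f : ConformalDual Witt)).eval x := rfl

theorem eq_zero_of_coordOn {S : Submodule ℂ[X] (ConformalDual Witt)} (f : S)
    (h : ∀ p, coordOn S p f = 0) : f = 0 :=
  Subtype.ext <| eq_zero_of_coord _ h

theorem tensorEval_tensorIncl (S : Submodule ℂ[X] (ConformalDual Witt)) (p q : ℕ × ℂ)
    (t : S ⊗[ℂ] S) :
    tensorEval (coord p) (coord q) (tensorIncl S t) =
      tensorEval (coordOn S p) (coordOn S q) t := by
  induction t with
  | zero => simp
  | add s t hs ht => simp only [map_add, hs, ht]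
  | tmul m n => simp [tensorIncl, coordOn]

/-! ### Goodness and coproducts in coordinates -/

/-- `t` represents the cobracket of `f`. -/
def IsCobracket (f : ConformalDual Witt) (t : ConformalDual Witt ⊗[ℂ] ConformalDual Witt) : Prop :=
  ∀ (i j : ℕ) (x y : ℂ),
    tensorEval (coord (i, x)) (coord (j, y)) t = (y - x) * (seq (i + j) f).eval (x + y)

theorem IsCobracket.unique {f : ConformalDual Witt}
    {s t : ConformalDual Witt ⊗[ℂ] ConformalDual Witt} (hs : IsCobracket f s)
    (ht : IsCobracket f t) : s = t :=
  eq_of_tensorEval eq_zero_of_coord eq_zero_of_coord fun ⟨i, x⟩ ⟨j, y⟩ => by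
    rw [hs i j x y, ht i j x y]

theorem piMap_single (w : ℂ) (f : ConformalDual Witt) (i j : ℕ) (p q : ℂ[X]) :
    piMap w f (Finsupp.single i p ⊗ₜ Finsupp.single j q) =
      C (p.eval (-w)) * q.comp (X + C w) * (2 * C w + X) * seq (i + j) f := by
  have h : piMap w f (Finsupp.single i p ⊗ₜ Finsupp.single j q) =
      f.toLin (substLambda (C w) (bracket (Finsupp.single i p) (Finsupp.single j q))) := rfl
  rw [h, subst_bracket_single, toLin_single, ← C_neg, comp_C, add_comm (C w) X]

theorem Phi_single (w : ℂ) (t : ConformalDual Witt ⊗[ℂ] ConformalDual Witt) (i j : ℕ)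
    (p q : ℂ[X]) :
    Phi (-w) t (Finsupp.single i p ⊗ₜ Finsupp.single j q) =
      C (p.eval (-w)) * q.comp (X + C w) * Phi (-w) t (gen i ⊗ₜ gen j) := by
  induction t with
  | zero => simp
  | add s t hs ht => simp only [map_add, LinearMap.add_apply, hs, ht, mul_add]
  | tmul f g =>
    rw [Phi_tmul, Phi_tmul, toLin_single, toLin_single, ← seq_apply, ← seq_apply, C_neg,
      sub_neg_eq_add, eval_mul, mul_comp, C_mul]
    ring

theorem eval_Phi_gen (w z : ℂ) (t : ConformalDual Witt ⊗[ℂ] ConformalDual Witt) (i j : ℕ) :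
    (Phi (-w) t (gen i ⊗ₜ gen j)).eval z = tensorEval (coord (i, -w)) (coord (j, z + w)) t := by
  induction t with
  | zero => simp
  | add s t hs ht => simp only [map_add, LinearMap.add_apply, eval_add, hs, ht]
  | tmul f g => simp [Phi_tmul, seq_apply]

/-- Both sides depend on the coefficients `p`, `q` through the same factor, so generators suffice.
There the substitution `x = -w`, `y = λ + w` turns `2w + λ` into `y - x`. -/
theorem piMap_eq_Phi_iff {f : ConformalDual Witt}
    {t : ConformalDual Witt ⊗[ℂ] ConformalDual Witt} :
    (∀ w, piMap w f = Phi (-w) t) ↔ IsCobracket f t := by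
  constructor
  · intro h i j x y
    have h1 := eval_Phi_gen (-x) (x + y) t i j
    rw [← h, gen, gen, piMap_single] at h1
    rw [show x + y + -x = y by ring, neg_neg] at h1
    rw [← h1]
    simp
    left; ring
  · intro h w
    refine TensorProduct.ext' fun a b => ?_
    induction a using Finsupp.induction_linear with
    | zero => simp
    | add a a' ha ha' => simp only [TensorProduct.add_tmul, map_add, ha, ha']
    | single i p =>
      induction b using Finsupp.induction_linear with
      | zero => simp
      | add b b' hb hb' => simp only [TensorProduct.tmul_add, map_add, hb, hb']
      | single j q =>
        rw [piMap_single, Phi_single, mul_assoc]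
        congr 1
        refine Polynomial.funext fun z => ?_
        rw [eval_Phi_gen, h]
        simp
        left; ring

theorem isGood_iff {S : Submodule ℂ[X] (ConformalDual Witt)} :
    IsGood S ↔ ∀ f ∈ S, ∃ t : S ⊗[ℂ] S, IsCobracket f (tensorIncl S t) := by
  simp only [IsGood, piMap_eq_Phi_iff, LinearMap.mem_range, exists_exists_eq_and]

theorem isCoproductOf_iff {S : Submodule ℂ[X] (ConformalDual Witt)} {δ : S →ₗ[ℂ] S ⊗[ℂ] S} :
    IsCoproductOf S δ ↔ ∀ f : S, IsCobracket (f : ConformalDual Witt) (tensorIncl S (δ f)) := by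
  simp only [IsCoproductOf, ← piMap_eq_Phi_iff, eq_comm]

theorem tensorIncl_injective (S : Submodule ℂ[X] (ConformalDual Witt)) :
    Function.Injective (tensorIncl S) := fun s t h =>
  eq_of_tensorEval eq_zero_of_coordOn eq_zero_of_coordOn fun p q => by
    rw [← tensorEval_tensorIncl, ← tensorEval_tensorIncl, h]

theorem IsCobracket.add {f g : ConformalDual Witt}
    {s t : ConformalDual Witt ⊗[ℂ] ConformalDual Witt} (hs : IsCobracket f s)
    (ht : IsCobracket g t) : IsCobracket (f + g) (s + t) := fun i j x y => by
  rw [map_add, hs, ht, map_add, eval_add, mul_add]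

theorem IsCobracket.smul {f : ConformalDual Witt} (c : ℂ)
    {t : ConformalDual Witt ⊗[ℂ] ConformalDual Witt} (ht : IsCobracket f t) :
    IsCobracket (c • f) (c • t) := fun i j x y => by
  rw [map_smul, ht, map_smul, eval_smul, smul_eq_mul, smul_eq_mul]; ring

theorem tensorEval_partialTensor (S : Submodule ℂ[X] (ConformalDual Witt)) (i j : ℕ) (x y : ℂ)
    (t : S ⊗[ℂ] S) :
    tensorEval (coordOn S (i, x)) (coordOn S (j, y)) (partialTensor S t) =
      -(x + y) * tensorEval (coordOn S (i, x)) (coordOn S (j, y)) t := by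
  induction t with
  | zero => simp
  | add s t hs ht => simp only [map_add, hs, ht, mul_add]
  | tmul m n =>
    simp [partialTensor, partialEnd, seq_smul]
    ring

theorem IsCobracket.partial {S : Submodule ℂ[X] (ConformalDual Witt)} {f : ConformalDual Witt}
    {t : S ⊗[ℂ] S} (ht : IsCobracket f (tensorIncl S t)) :
    IsCobracket ((X : ℂ[X]) • f) (tensorIncl S (partialTensor S t)) := fun i j x y => by
  rw [tensorEval_tensorIncl, tensorEval_partialTensor, ← tensorEval_tensorIncl, ht, seq_smul]
  simp
  ring

/-- Uniqueness of cobrackets makes any pointwise choice of them linear. -/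
theorem exists_isCoproductOf {S : Submodule ℂ[X] (ConformalDual Witt)} (hS : IsGood S) :
    ∃ δ, IsCoproductOf S δ := by
  choose t ht using fun f : S => isGood_iff.1 hS f f.2
  refine ⟨⟨⟨t, fun f g => ?_⟩, fun c f => ?_⟩, isCoproductOf_iff.2 ht⟩
  · apply tensorIncl_injective
    rw [map_add]
    exact (ht (f + g)).unique ((ht f).add (ht g))
  · apply tensorIncl_injective
    rw [map_smul]
    exact (ht (c • f)).unique ((ht f).smul c)

/-! ### The differential Lie coalgebra axioms -/

section Coproduct

variable {S : Submodule ℂ[X] (ConformalDual Witt)} {δ : S →ₗ[ℂ] S ⊗[ℂ] S}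

theorem eq_of_isCoproductOf {δ' : S →ₗ[ℂ] S ⊗[ℂ] S} (h' : IsCoproductOf S δ')
    (h : IsCoproductOf S δ) : δ' = δ :=
  LinearMap.ext fun f => tensorIncl_injective S <|
    (isCoproductOf_iff.1 h' f).unique (isCoproductOf_iff.1 h f)

/-- Dually, the coordinates satisfy the Witt-type relation `[c_{i,x}, c_{j,y}] = (y - x)
c_{i+j,x+y}`. The coalgebra axioms are the Lie axioms for this bracket. -/
theorem tensorEval_coproduct (h : IsCoproductOf S δ) (i j : ℕ) (x y : ℂ) :
    tensorEval (coordOn S (i, x)) (coordOn S (j, y)) ∘ₗ δ = (y - x) • coordOn S (i + j, x + y) :=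
  LinearMap.ext fun f => by
    rw [LinearMap.comp_apply, ← tensorEval_tensorIncl, isCoproductOf_iff.1 h f]
    simp

theorem tensorEval_coproduct_apply (h : IsCoproductOf S δ) (i j : ℕ) (x y : ℂ) (f : S) :
    tensorEval (coordOn S (i, x)) (coordOn S (j, y)) (δ f) =
      (y - x) * coordOn S (i + j, x + y) f :=
  LinearMap.congr_fun (tensorEval_coproduct h i j x y) f

theorem isDifferentialLieCoalgebra_of_isCoproductOf (h : IsCoproductOf S δ) :
    IsDifferentialLieCoalgebra δ where
  map_partial c := tensorIncl_injective S <|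
    (isCoproductOf_iff.1 h _).unique (isCoproductOf_iff.1 h c).partial
  coskew c := by
    refine eq_of_tensorEval eq_zero_of_coordOn eq_zero_of_coordOn fun ⟨i, x⟩ ⟨j, y⟩ => ?_
    refine Eq.trans ?_ (map_neg (tensorEval (coordOn S (i, x)) (coordOn S (j, y))) (δ c)).symm
    rw [tensorEval_comm, tensorEval_coproduct_apply h, tensorEval_coproduct_apply h,
      add_comm j i, add_comm y x]
    ring
  cojacobi c := by
    refine eq_of_tensorEval (ψ := fun p : (ℕ × ℂ) × (ℕ × ℂ) =>
      tensorEval (coordOn S p.1) (coordOn S p.2)) eq_zero_of_coordOn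
      (fun t ht => eq_zero_of_tensorEval eq_zero_of_coordOn eq_zero_of_coordOn
        fun p q => ht (p, q)) ?_
    rintro ⟨i, x⟩ ⟨⟨j, y⟩, ⟨k, z⟩⟩
    simp only [map_sub, tensorEval_leftComm, tensorEval_assoc, tensorEval_lTensor,
      tensorEval_rTensor, tensorEval_coproduct h, tensorEval_smul_left, tensorEval_smul_right,
      tensorEval_coproduct_apply h]
    rw [show j + (i + k) = i + (j + k) by ring, show i + j + k = i + (j + k) by ring,
      show y + (x + z) = x + (y + z) by ring, show x + y + z = x + (y + z) by ring]
    -- The identity is `(z - y)(y + z - x) - (z - x)(x + z - y) = (y - x)(z - x - y)`.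
    ring

/-- Good submodules of `S` are subcoalgebras of `S`. -/
theorem isSubcoalgebra_of_isGood (h : IsCoproductOf S δ) {N : Submodule ℂ[X] S}
    (hN : IsGood (N.map S.subtype)) : IsSubcoalgebra δ N := by
  intro f hf
  obtain ⟨t, ht⟩ := isGood_iff.1 hN f ⟨f, hf, rfl⟩
  let e : N ≃ₗ[ℂ] N.map S.subtype :=
    (N.equivMapOfInjective S.subtype S.subtype_injective).restrictScalars ℂ
  refine ⟨TensorProduct.map e.symm.toLinearMap e.symm.toLinearMap t, tensorIncl_injective S ?_⟩
  -- The cobracket found in `N ⊗ N` must be `δ f`, since an element has only one.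
  refine IsCobracket.unique ?_ (isCoproductOf_iff.1 h f)
  convert ht using 1
  have he : ∀ n, ((e.symm n : S) : ConformalDual Witt) = n := fun n => by
    obtain ⟨m, rfl⟩ := e.surjective n
    rw [e.symm_apply_apply]; rfl
  clear ht
  induction t with
  | zero => simp
  | add s t hs ht => simp only [map_add, hs, ht]
  | tmul m n => simp [tensorIncl, he]

end Coproduct

/-! ### Good submodules inside `V + U` -/

/-- The elements with cobracket in `S ⊗ S`. -/
def cobracketIn (S : Submodule ℂ[X] (ConformalDual Witt)) :
    Submodule ℂ[X] (ConformalDual Witt) where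
  carrier := {f | ∃ t : S ⊗[ℂ] S, IsCobracket f (tensorIncl S t)}
  zero_mem' := ⟨0, fun i j x y => by simp⟩
  add_mem' := by
    rintro f g ⟨s, hs⟩ ⟨t, ht⟩
    exact ⟨s + t, by rw [map_add]; exact hs.add ht⟩
  smul_mem' := by
    rintro p f ⟨t, ht⟩
    induction p using Polynomial.induction_on' with
    | add p q hp hq =>
      obtain ⟨s, hs⟩ := hp
      obtain ⟨t, ht⟩ := hq
      exact ⟨s + t, by rw [map_add, add_smul]; exact hs.add ht⟩
    | monomial n c =>
      induction n generalizing f t with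
      | zero =>
        refine ⟨c • t, ?_⟩
        rw [monomial_zero_left, ← algebraMap_eq, algebraMap_smul, map_smul]
        exact ht.smul c
      | succ n ih =>
        rw [← monomial_mul_X, mul_smul]
        exact ih _ ht.partial

theorem mem_cobracketIn_of_tmul {S : Submodule ℂ[X] (ConformalDual Witt)} {f : ConformalDual Witt}
    {t : S ⊗[ℂ] S} (ht : IsCobracket f (tensorIncl S t)) : f ∈ cobracketIn S := ⟨t, ht⟩

theorem isGood_iff_le {S : Submodule ℂ[X] (ConformalDual Witt)} :
    IsGood S ↔ S ≤ cobracketIn S := isGood_iff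

theorem cobracketIn_mono {S S' : Submodule ℂ[X] (ConformalDual Witt)} (h : S ≤ S') :
    cobracketIn S ≤ cobracketIn S' := by
  rintro f ⟨t, ht⟩
  let ι : S →ₗ[ℂ] S' := (Submodule.inclusion h).restrictScalars ℂ
  refine ⟨TensorProduct.map ι ι t, ?_⟩
  convert ht using 1
  clear ht
  induction t with
  | zero => simp
  | add s t hs ht => simp only [map_add, hs, ht]
  | tmul m n => simp [tensorIncl, ι]

theorem isGood_sup {S S' : Submodule ℂ[X] (ConformalDual Witt)} (h : IsGood S) (h' : IsGood S') :
    IsGood (S ⊔ S') := by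
  rw [isGood_iff_le] at *
  exact sup_le (h.trans (cobracketIn_mono le_sup_left)) (h'.trans (cobracketIn_mono le_sup_right))

/-- The cobracket of `f_{a,m}` in a submodule that contains `f_{a,0}, …, f_{a,m}`. -/
theorem isCobracket_fam {S : Submodule ℂ[X] (ConformalDual Witt)} (a : ℂˣ) (m : ℕ) (g : ℕ → S)
    (hg : ∀ j ≤ m, (g j : ConformalDual Witt) = fam a j) :
    IsCobracket (fam a m) (tensorIncl S (∑ j ∈ Finset.range (m + 1), (m.choose j : ℂ) •
      (((X : ℂ[X]) • g j) ⊗ₜ[ℂ] g (m - j) - g j ⊗ₜ[ℂ] ((X : ℂ[X]) • g (m - j))))) := by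
  intro i j x y
  -- Expanding `a^{i+j} (i + j)^m` gives the summands; the factor `y - x` appears because `∂` acts
  -- as `-x` on the left and `-y` on the right.
  rw [tensorEval_tensorIncl, map_sum, seq_fam, eval_C, Nat.cast_add, add_pow, pow_add,
    Finset.mul_sum, Finset.mul_sum]
  refine Finset.sum_congr rfl fun k hk => ?_
  have hk : k ≤ m := by simpa [Nat.lt_succ_iff] using hk
  simp [seq_smul, hg k hk, hg (m - k) (Nat.sub_le m k), seq_fam]
  ring

/-- The cobracket of `L_n^*` in a submodule that contains `L_0^*, …, L_n^*`. -/
theorem isCobracket_genDual {S : Submodule ℂ[X] (ConformalDual Witt)} (n : ℕ) (g : ℕ → S)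
    (hg : ∀ j ≤ n, (g j : ConformalDual Witt) = genDual j) :
    IsCobracket (genDual n) (tensorIncl S (∑ j ∈ Finset.range (n + 1),
      (((X : ℂ[X]) • g j) ⊗ₜ[ℂ] g (n - j) - g j ⊗ₜ[ℂ] ((X : ℂ[X]) • g (n - j))))) := by
  intro i j x y
  rw [tensorEval_tensorIncl, map_sum, seq_genDual]
  -- Only the summand `k = i` can survive, and it does so exactly when `j = n - i`.
  have : ∀ k ∈ Finset.range (n + 1), tensorEval (coordOn S (i, x)) (coordOn S (j, y))
      (((X : ℂ[X]) • g k) ⊗ₜ[ℂ] g (n - k) - g k ⊗ₜ[ℂ] ((X : ℂ[X]) • g (n - k))) =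
      if i = k then (if i + j = n then y - x else 0) else 0 := by
    intro k hk
    have hk : k ≤ n := by simpa [Nat.lt_succ_iff] using hk
    simp only [map_sub, tensorEval_tmul, coordOn_apply, Submodule.coe_smul, seq_smul, hg k hk,
      hg (n - k) (Nat.sub_le n k), seq_genDual, X_comp]
    by_cases h1 : i = k
    · by_cases h2 : i + j = n
      · rw [if_pos h1, if_pos (by omega : j = n - k), if_pos h1, if_pos h2]
        simp; ring
      · rw [if_neg (by omega : ¬ j = n - k), if_neg h2]
        simp
    · simp [h1]
  rw [Finset.sum_congr rfl this, Finset.sum_ite_eq]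
  by_cases h2 : i + j = n
  · rw [if_pos (Finset.mem_range.2 (by omega)), if_pos h2, if_pos h2]; simp
  · simp [h2]

/-- `⨁_{j ≤ m} ℂ[∂] f_{a,j}`. -/
def famSpan (a : ℂˣ) (m : ℕ) : Submodule ℂ[X] (ConformalDual Witt) :=
  Submodule.span ℂ[X] (Set.range fun j : Fin (m + 1) => fam a j)

/-- `⨁_{j ≤ n} ℂ[∂] L_j^*`. -/
def genSpan (n : ℕ) : Submodule ℂ[X] (ConformalDual Witt) :=
  Submodule.span ℂ[X] (Set.range fun j : Fin (n + 1) => genDual j)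

theorem fam_mem_famSpan (a : ℂˣ) {j m : ℕ} (h : j ≤ m) : fam a j ∈ famSpan a m :=
  Submodule.subset_span ⟨⟨j, Nat.lt_succ_of_le h⟩, rfl⟩

theorem genDual_mem_genSpan {j n : ℕ} (h : j ≤ n) : genDual j ∈ genSpan n :=
  Submodule.subset_span ⟨⟨j, Nat.lt_succ_of_le h⟩, rfl⟩

theorem fam_mem_cobracketIn {a : ℂˣ} {m : ℕ} {S : Submodule ℂ[X] (ConformalDual Witt)}
    (h : ∀ j ≤ m, fam a j ∈ S) : fam a m ∈ cobracketIn S := by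
  classical
  -- The formula only involves indices at most `m`, so the default value `0` is harmless.
  exact mem_cobracketIn_of_tmul (isCobracket_fam a m
    (fun j => if hj : j ≤ m then ⟨fam a j, h j hj⟩ else 0) fun j hj => by simp [hj])

theorem genDual_mem_cobracketIn {n : ℕ} {S : Submodule ℂ[X] (ConformalDual Witt)}
    (h : ∀ j ≤ n, genDual j ∈ S) : genDual n ∈ cobracketIn S := by
  classical
  exact mem_cobracketIn_of_tmul (isCobracket_genDual n
    (fun j => if hj : j ≤ n then ⟨genDual j, h j hj⟩ else 0) fun j hj => by simp [hj])

theorem isGood_famSpan (a : ℂˣ) (m : ℕ) : IsGood (famSpan a m) := by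
  rw [isGood_iff_le]
  refine Submodule.span_le.2 ?_
  rintro _ ⟨j, rfl⟩
  exact fam_mem_cobracketIn fun k hk => fam_mem_famSpan a (by omega)

theorem isGood_genSpan (n : ℕ) : IsGood (genSpan n) := by
  rw [isGood_iff_le]
  refine Submodule.span_le.2 ?_
  rintro _ ⟨j, rfl⟩
  exact genDual_mem_cobracketIn fun k hk => genDual_mem_genSpan (by omega)

theorem isGood_U : IsGood U := by
  rw [isGood_iff_le]
  refine Submodule.span_le.2 ?_
  rintro _ ⟨⟨a, m⟩, rfl⟩
  exact fam_mem_cobracketIn fun k _ => Submodule.subset_span ⟨(a, k), rfl⟩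

theorem isGood_V : IsGood V := by
  rw [isGood_iff_le]
  refine Submodule.span_le.2 ?_
  rintro _ ⟨n, rfl⟩
  exact genDual_mem_cobracketIn fun k _ => Submodule.subset_span ⟨k, rfl⟩

/-- Every element of `V + U` lies in a finitely generated good submodule. -/
theorem exists_isGood_fg {f : ConformalDual Witt} (hf : f ∈ V ⊔ U) :
    ∃ N : Submodule ℂ[X] (ConformalDual Witt), IsGood N ∧ N.FG ∧ f ∈ N := by
  rw [V, U, ← Submodule.span_union] at hf
  induction hf using Submodule.span_induction with
  | zero =>
    exact ⟨genSpan 0, isGood_genSpan 0, Submodule.fg_span (Set.finite_range _), zero_mem _⟩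
  | mem f hf =>
    rcases hf with ⟨n, rfl⟩ | ⟨⟨a, m⟩, rfl⟩
    · exact ⟨genSpan n, isGood_genSpan n, Submodule.fg_span (Set.finite_range _),
        genDual_mem_genSpan le_rfl⟩
    · exact ⟨famSpan a m, isGood_famSpan a m, Submodule.fg_span (Set.finite_range _),
        fam_mem_famSpan a le_rfl⟩
  | add f g _ _ hf hg =>
    obtain ⟨N, h1, h2, h3⟩ := hf
    obtain ⟨N', h1', h2', h3'⟩ := hg
    exact ⟨N ⊔ N', isGood_sup h1 h1', h2.sup h2', Submodule.add_mem_sup h3 h3'⟩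
  | smul p f _ hf =>
    obtain ⟨N, h1, h2, h3⟩ := hf
    exact ⟨N, h1, h2, N.smul_mem p h3⟩

end Witt

/-- A finitely generated torsion-free module over the principal ideal domain `ℂ[∂]` is free, and its
torsion part is zero. -/
theorem isFiniteRank_of_fg {M : Type*} [AddCommGroup M] [Module ℂ[X] M]
    [Module.IsTorsionFree ℂ[X] M] {N : Submodule ℂ[X] M} (hN : N.FG) : IsFiniteRank N := by
  have : Module.Finite ℂ[X] N := Module.Finite.iff_fg.2 hN
  let b := Module.finBasis ℂ[X] N
  refine ⟨_, b, b.linearIndependent, ?_⟩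
  rw [b.span_eq, Submodule.isTorsionFree_iff_torsion_eq_bot.1 inferInstance]
  exact isCompl_top_bot

namespace Witt

/-! ### The shift and recursive sequences -/

/-- The shift `(E f)_λ(L_i) = f_λ(L_{i+1})`. -/
def shift : Module.End ℂ[X] (ConformalDual Witt) where
  toFun f := dualOf fun i => seq (i + 1) f
  map_add' f g := ext_seq fun i => by simp [seq_dualOf]
  map_smul' p f := ext_seq fun i => by simp [seq_dualOf, seq_smul]

theorem seq_shift (f : ConformalDual Witt) (i : ℕ) : seq i (shift f) = seq (i + 1) f :=
  seq_dualOf _ i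

theorem seq_shift_pow (k : ℕ) (f : ConformalDual Witt) (i : ℕ) :
    seq i ((shift ^ k) f) = seq (i + k) f := by
  induction k generalizing f with
  | zero => simp
  | succ k ih => rw [pow_succ, Module.End.mul_apply, ih, seq_shift, add_assoc]

theorem seq_aeval_shift (q : ℂ[X]) (f : ConformalDual Witt) (i : ℕ) :
    seq i (aeval shift q f) =
      ∑ s ∈ Finset.range (q.natDegree + 1), q.coeff s • seq (i + s) f := by
  rw [aeval_eq_sum_range, LinearMap.sum_apply, map_sum]
  simp [seq_shift_pow]

theorem isRecursive_iff {f : ConformalDual Witt} :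
    IsRecursive f ↔ ∃ q : ℂ[X], q ≠ 0 ∧ aeval shift q f = 0 := by
  constructor
  · rintro ⟨N, r, β, ⟨s, hs, hβ⟩, h⟩
    -- The factor `X ^ N` absorbs the threshold `N`: applying `E^N` drops the first `N` terms.
    refine ⟨X ^ N * ∑ s ∈ Finset.range (r + 1), monomial s (β s),
      mul_ne_zero (pow_ne_zero _ X_ne_zero) fun h0 => hβ ?_, ext_seq fun i => ?_⟩
    · have := congrArg (fun p => p.coeff s) h0
      simpa [finsetSum_coeff, coeff_monomial, Nat.lt_succ_iff, hs] using this
    · rw [map_mul, Module.End.mul_apply, map_pow, aeval_X, seq_shift_pow, map_sum,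
        LinearMap.sum_apply, map_sum, map_zero, ← h (i + N) (Nat.le_add_left N i)]
      refine Finset.sum_congr rfl fun s _ => ?_
      rw [aeval_monomial, Module.End.mul_apply, Module.algebraMap_end_apply, map_smul,
        seq_shift_pow, seq_apply]
  · rintro ⟨q, hq, h⟩
    refine ⟨0, q.natDegree, q.coeff, ⟨q.natDegree, le_rfl, by simpa using hq⟩, fun n _ => ?_⟩
    have := seq_aeval_shift q f n
    rw [h, map_zero] at this
    exact this.symm

theorem shift_fam (a : ℂˣ) (m : ℕ) :
    shift (fam a m) = (a : ℂ) • ∑ j ∈ Finset.range (m + 1), (m.choose j : ℂ) • fam a j := by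
  refine ext_seq fun i => ?_
  rw [seq_shift, seq_fam, map_smul, map_sum, Nat.cast_add, Nat.cast_one, add_pow]
  simp_rw [map_smul, seq_fam, smul_eq_C_mul, ← C_mul, ← map_sum, ← C_mul]
  congr 1
  rw [Finset.mul_sum, Finset.mul_sum]
  refine Finset.sum_congr rfl fun k _ => ?_
  ring

/-- On `f_{a,0}, …, f_{a,m}` the operator `E - b` is triangular with diagonal entry `a - b`, since
`(i + 1)^m` has leading term `i^m`. -/
theorem shift_sub_fam (a : ℂˣ) (b : ℂ) (m : ℕ) :
    shift (fam a m) - b • fam a m = ((a : ℂ) - b) • fam a m +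
      (a : ℂ) • ∑ j ∈ Finset.range m, (m.choose j : ℂ) • fam a j := by
  rw [shift_fam, Finset.sum_range_succ]
  simp
  module

theorem shift_genDual_zero : shift (genDual 0) = 0 :=
  ext_seq fun i => by simp [seq_shift, seq_genDual]

theorem shift_genDual_succ (j : ℕ) : shift (genDual (j + 1)) = genDual j :=
  ext_seq fun i => by simp [seq_shift, seq_genDual]

/-- A submodule with `(E - a) f ∈ K → f ∈ K` contains all `f_{a,m}`. -/
theorem fam_mem_of_shift_sub {K : Submodule ℂ[X] (ConformalDual Witt)} (a : ℂˣ)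
    (h : ∀ f, shift f - (a : ℂ) • f ∈ K → f ∈ K) (m : ℕ) : fam a m ∈ K := by
  induction m using Nat.strong_induction_on with
  | _ m ih =>
    apply h
    rw [shift_sub_fam, sub_self, zero_smul, zero_add]
    exact Submodule.smul_of_tower_mem K _ <| Submodule.sum_mem _ fun j hj =>
      Submodule.smul_of_tower_mem K _ (ih j (Finset.mem_range.1 hj))

theorem genDual_mem_of_shift {K : Submodule ℂ[X] (ConformalDual Witt)}
    (h : ∀ f, shift f ∈ K → f ∈ K) (j : ℕ) : genDual j ∈ K := by
  induction j with
  | zero => exact h _ (by rw [shift_genDual_zero]; exact zero_mem _)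
  | succ j ih => exact h _ (by rwa [shift_genDual_succ])

/-- The sequences annihilated by a nonzero polynomial in the shift. -/
def recursive : Submodule ℂ[X] (ConformalDual Witt) where
  carrier := {f | IsRecursive f}
  zero_mem' := isRecursive_iff.2 ⟨1, one_ne_zero, map_zero _⟩
  add_mem' := by
    intro f g hf hg
    obtain ⟨p, hp, hpf⟩ := isRecursive_iff.1 hf
    obtain ⟨q, hq, hqg⟩ := isRecursive_iff.1 hg
    refine isRecursive_iff.2 ⟨p * q, mul_ne_zero hp hq, ?_⟩
    rw [map_add, map_mul, Module.End.mul_apply _ _ g, hqg, map_zero, add_zero,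
      ← map_mul, mul_comm, map_mul, Module.End.mul_apply, hpf, map_zero]
  smul_mem' := by
    intro p f hf
    obtain ⟨q, hq, hqf⟩ := isRecursive_iff.1 hf
    exact isRecursive_iff.2 ⟨q, hq, by rw [map_smul, hqf, smul_zero]⟩

theorem mem_recursive {f : ConformalDual Witt} : f ∈ recursive ↔ IsRecursive f := Iff.rfl

theorem mem_recursive_of_shift_sub (a : ℂ) (f : ConformalDual Witt)
    (h : shift f - a • f ∈ recursive) : f ∈ recursive := by
  obtain ⟨q, hq, hqf⟩ := isRecursive_iff.1 h
  refine isRecursive_iff.2 ⟨q * (X - C a), mul_ne_zero hq (X_sub_C_ne_zero a), ?_⟩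
  simpa [Module.algebraMap_end_apply] using hqf

theorem sup_le_recursive : V ⊔ U ≤ recursive := by
  refine sup_le (Submodule.span_le.2 ?_) (Submodule.span_le.2 ?_)
  · rintro _ ⟨j, rfl⟩
    exact genDual_mem_of_shift
      (fun f hf => mem_recursive_of_shift_sub 0 f (by rwa [zero_smul, sub_zero])) j
  · rintro _ ⟨⟨a, m⟩, rfl⟩
    exact fam_mem_of_shift_sub a (mem_recursive_of_shift_sub a) m

theorem genDual_mem_sup (j : ℕ) : genDual j ∈ V ⊔ U :=
  Submodule.mem_sup_left (Submodule.subset_span ⟨j, rfl⟩)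

theorem fam_mem_sup (a : ℂˣ) (m : ℕ) : fam a m ∈ V ⊔ U :=
  Submodule.mem_sup_right (Submodule.subset_span ⟨(a, m), rfl⟩)

/-! ### Every recursive sequence lies in `V + U` -/

/-- `E - a` as a `ℂ[∂]`-linear map. -/
def shiftSub (a : ℂ) : Module.End ℂ[X] (ConformalDual Witt) := shift - algebraMap ℂ _ a

theorem shiftSub_apply (a : ℂ) (f : ConformalDual Witt) : shiftSub a f = shift f - a • f := rfl

/-- `E - b` maps `V + U` onto a module that contains `V + U`. -/
theorem sup_le_map_shiftSub (b : ℂ) : V ⊔ U ≤ (V ⊔ U).map (shiftSub b) := by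
  refine sup_le (Submodule.span_le.2 ?_) (Submodule.span_le.2 ?_)
  · rintro _ ⟨j, rfl⟩
    by_cases hb : b = 0
    · refine ⟨genDual (j + 1), genDual_mem_sup _, ?_⟩
      rw [shiftSub_apply, shift_genDual_succ, hb, zero_smul, sub_zero]
    -- For `b ≠ 0`, solving `(E - b) f = E f - b f` for `f` reduces `L_j^*` to `E L_j^*`, which is
    -- `L_{j-1}^*` or `0`.
    · have key : ∀ f, shift f ∈ (V ⊔ U).map (shiftSub b) → f ∈ V ⊔ U →
          f ∈ (V ⊔ U).map (shiftSub b) := fun f hf hf' => by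
        have h1 : shiftSub b f ∈ (V ⊔ U).map (shiftSub b) := ⟨f, hf', rfl⟩
        have h2 : f = b⁻¹ • (shift f - shiftSub b f) := by
          rw [shiftSub_apply, sub_sub_cancel, smul_smul, inv_mul_cancel₀ hb, one_smul]
        rw [h2]
        exact Submodule.smul_of_tower_mem _ _ (sub_mem hf h1)
      change genDual j ∈ _
      induction j with
      | zero => exact key _ (by rw [shift_genDual_zero]; exact zero_mem _) (genDual_mem_sup _)
      | succ j ih => exact key _ (by rwa [shift_genDual_succ]) (genDual_mem_sup _)
  · rintro _ ⟨⟨a, m⟩, rfl⟩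
    change fam a m ∈ _
    induction m using Nat.strong_induction_on with
    | _ m ih =>
      by_cases hab : (a : ℂ) = b
      -- When `a = b` the diagonal vanishes, so the preimage is sought one step higher: `(E - a)
      -- f_{a,m+1}` has leading term `a (m + 1) f_{a,m}`.
      · have h1 : shiftSub b (fam a (m + 1)) ∈ (V ⊔ U).map (shiftSub b) :=
          ⟨_, fam_mem_sup _ _, rfl⟩
        rw [shiftSub_apply, shift_sub_fam, sub_eq_zero.2 hab, zero_smul, zero_add,
          Finset.sum_range_succ] at h1
        have h2 : ∑ j ∈ Finset.range m, ((m + 1).choose j : ℂ) • fam a j ∈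
            (V ⊔ U).map (shiftSub b) :=
          Submodule.sum_mem _ fun j hj =>
            Submodule.smul_of_tower_mem _ _ (ih j (Finset.mem_range.1 hj))
        have h3 : ((m + 1).choose m : ℂ) ≠ 0 := by
          simp [Nat.choose_succ_self_right, Nat.cast_add_one_ne_zero]
        have h4 := sub_mem (Submodule.smul_of_tower_mem _ (a : ℂ)⁻¹ h1) h2
        rw [smul_smul, inv_mul_cancel₀ a.ne_zero, one_smul, add_sub_cancel_left] at h4
        have h5 := Submodule.smul_of_tower_mem _ ((m + 1).choose m : ℂ)⁻¹ h4
        rwa [smul_smul, inv_mul_cancel₀ h3, one_smul] at h5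
      · have h1 : shiftSub b (fam a m) ∈ (V ⊔ U).map (shiftSub b) :=
          ⟨_, fam_mem_sup _ _, rfl⟩
        rw [shiftSub_apply, shift_sub_fam] at h1
        have h2 : (a : ℂ) • ∑ j ∈ Finset.range m, (m.choose j : ℂ) • fam a j ∈
            (V ⊔ U).map (shiftSub b) :=
          Submodule.smul_of_tower_mem _ _ <| Submodule.sum_mem _ fun j hj =>
            Submodule.smul_of_tower_mem _ _ (ih j (Finset.mem_range.1 hj))
        have h4 := sub_mem h1 h2
        rw [add_sub_cancel_right] at h4
        have h5 := Submodule.smul_of_tower_mem _ ((a : ℂ) - b)⁻¹ h4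
        rwa [smul_smul, inv_mul_cancel₀ (sub_ne_zero.2 hab), one_smul] at h5

/-- The kernel of `E - b` consists of the geometric sequences `b^i f_λ(L_0)`, which are
`ℂ[∂]`-multiples of `L_0^*` if `b = 0` and of `f_{b,0}` otherwise. The multiplier is composed with
`-X` because `∂` acts as `-λ`. -/
theorem mem_sup_of_shiftSub_eq_zero {b : ℂ} {f : ConformalDual Witt} (h : shiftSub b f = 0) :
    f ∈ V ⊔ U := by
  rw [shiftSub_apply, sub_eq_zero] at h
  have h1 : ∀ i, seq i f = b ^ i • seq 0 f := fun i => by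
    induction i with
    | zero => simp
    | succ i ih => rw [← seq_shift, h, map_smul, ih, smul_smul, pow_succ']
  by_cases hb : b = 0
  · have : f = (seq 0 f).comp (-X) • genDual 0 := ext_seq fun i => by
      rw [h1 i, seq_smul, seq_genDual, comp_assoc, hb]
      rcases i with - | i <;> simp
    rw [this]
    exact Submodule.smul_mem _ _ (genDual_mem_sup 0)
  · have : f = (seq 0 f).comp (-X) • fam (Units.mk0 b hb) 0 := ext_seq fun i => by
      rw [h1 i, seq_smul, seq_fam, comp_assoc]
      simp [smul_eq_C_mul, mul_comm]
    rw [this]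
    exact Submodule.smul_mem _ _ (fam_mem_sup _ 0)

/-- Some `g` in `V + U` has the same image as `f`, and `f - g` lies in the kernel of `E - b`. -/
theorem mem_sup_of_shiftSub_mem {b : ℂ} {f : ConformalDual Witt} (h : shiftSub b f ∈ V ⊔ U) :
    f ∈ V ⊔ U := by
  obtain ⟨g, hg, hgf⟩ := sup_le_map_shiftSub b h
  rw [← sub_add_cancel f g]
  exact add_mem (mem_sup_of_shiftSub_eq_zero (b := b) (by rw [map_sub, hgf, sub_self])) hg

theorem mem_sup_of_aeval_mem (s : Multiset ℂ) {f : ConformalDual Witt}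
    (h : aeval shift (s.map fun a => X - C a).prod f ∈ V ⊔ U) : f ∈ V ⊔ U := by
  induction s using Multiset.induction_on generalizing f with
  | empty => simpa using h
  | cons a s ih =>
    rw [Multiset.map_cons, Multiset.prod_cons, mul_comm, map_mul, Module.End.mul_apply] at h
    refine mem_sup_of_shiftSub_mem (b := a) (ih ?_)
    simpa [shiftSub] using h

theorem recursive_eq : recursive = V ⊔ U := by
  refine le_antisymm (fun f hf => ?_) sup_le_recursive
  obtain ⟨q, hq, hqf⟩ := isRecursive_iff.1 hf
  apply mem_sup_of_aeval_mem q.roots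
  have h := (IsAlgClosed.splits q).eq_prod_roots
  rw [h, map_mul, aeval_C, Module.End.mul_apply, Module.algebraMap_end_apply] at hqf
  rw [(smul_eq_zero.1 hqf).resolve_left (leadingCoeff_ne_zero.2 hq)]
  exact zero_mem _

/-! ### Good submodules consist of recursive sequences -/

theorem isGood_le_recursive {S : Submodule ℂ[X] (ConformalDual Witt)} (hS : IsGood S) :
    S ≤ recursive := by
  intro f hf
  obtain ⟨t, ht⟩ := isGood_iff.1 hS f hf
  generalize tensorIncl S t = t at ht
  obtain ⟨n, u, v, rfl⟩ : ∃ (n : ℕ) (u v : Fin n → ConformalDual Witt),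
      t = ∑ k, u k ⊗ₜ[ℂ] v k := TensorProduct.exists_sum_tmul_eq t
  -- These are `n + 1` vectors in `ℂ^n`; a relation among them is the recursion.
  have hdep : ¬ LinearIndependent ℂ fun (i : Fin (n + 1)) (k : Fin n) => coord (i, 0) (u k) :=
    fun hli => by simpa using hli.fintype_card_le_finrank
  obtain ⟨β, hβ, i₀, hi₀⟩ := Fintype.not_linearIndependent_iff.1 hdep
  refine mem_recursive.2 ⟨0, n, fun i => if h : i < n + 1 then β ⟨i, h⟩ else 0,
    ⟨i₀, by omega, by simpa [Nat.lt_succ_iff.1 i₀.2] using hi₀⟩, fun j _ => ?_⟩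
  rw [Finset.sum_range]
  simp only [Fin.is_lt, dite_true, Fin.eta]
  -- At `x = 0` the cobracket identity reads `y f_y(L_{i+j}) = ∑ (u_k)_0(L_i) (v_k)_y(L_j)`. The
  -- relation `β` on the `i`-side thus works for all `j` and `y`, and the factor `y` cancels
  -- afterwards.
  have key : ∀ y : ℂ, y * (∑ i, β i • f.toLin (gen (j + i))).eval y = 0 := fun y => by
    have h1 : ∀ i : Fin (n + 1), y * (f.toLin (gen (j + i))).eval y =
        ∑ k, coord (i, 0) (u k) * coord (j, y) (v k) := fun i => by
      have := ht i j 0 y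
      rw [map_sum, sub_zero, zero_add, add_comm (i : ℕ) j] at this
      rw [← seq_apply, ← this]
      simp
    rw [eval_finsetSum, Finset.mul_sum]
    simp_rw [eval_smul, smul_eq_mul, mul_left_comm y, h1, Finset.mul_sum]
    rw [Finset.sum_comm]
    refine Finset.sum_eq_zero fun k _ => ?_
    have h2 := congrFun hβ k
    simp only [Finset.sum_apply, Pi.smul_apply, smul_eq_mul, Pi.zero_apply] at h2
    simp_rw [← mul_assoc]
    rw [← Finset.sum_mul, h2, zero_mul]
  have h3 : (X : ℂ[X]) * ∑ i, β i • f.toLin (gen (j + i)) = 0 :=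
    Polynomial.funext fun y => by rw [eval_mul, eval_X, key, eval_zero]
  exact (mul_eq_zero.1 h3).resolve_left X_ne_zero

theorem upperZero_eq : upperZero Witt = V ⊔ U :=
  le_antisymm (sSup_le fun _ hS => (isGood_le_recursive hS).trans recursive_eq.le)
    (sup_le (le_sSup isGood_V) (le_sSup isGood_U))

/-! ### Linear independence -/

/-- The families `L_j^*` and `f_{a,m}`, indexed by the eigenvalue of the shift. -/
def eigenFamily : Option ℂˣ → ℕ → ConformalDual Witt
  | none => genDual
  | some a => fam a

/-- The eigenvalue of the shift in `ℂ[∂]`. -/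
def eigenvalue : Option ℂˣ → ℂ[X]
  | none => 0
  | some a => C (a : ℂ)

theorem eigenvalue_injective : Function.Injective eigenvalue := by
  rintro (_ | a) (_ | b) h
  · rfl
  · exact absurd (C_eq_zero.1 h.symm) b.ne_zero
  · exact absurd (C_eq_zero.1 h) a.ne_zero
  · exact congrArg some (Units.ext (C_injective h))

theorem mem_maxGenEigenspace_of_sub {μ : ℂ[X]} {f : ConformalDual Witt}
    (h : shift f - μ • f ∈ shift.maxGenEigenspace μ) : f ∈ shift.maxGenEigenspace μ := by
  rw [Module.End.mem_maxGenEigenspace] at h ⊢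
  obtain ⟨k, hk⟩ := h
  exact ⟨k + 1, by rw [pow_succ, Module.End.mul_apply]; exact hk⟩

theorem eigenFamily_mem (x : Option ℂˣ) (m : ℕ) :
    eigenFamily x m ∈ shift.maxGenEigenspace (eigenvalue x) := by
  rcases x with _ | a
  · refine genDual_mem_of_shift (fun f hf => mem_maxGenEigenspace_of_sub ?_) m
    rwa [eigenvalue, zero_smul, sub_zero]
  · refine fam_mem_of_shift_sub a (fun f hf => mem_maxGenEigenspace_of_sub ?_) m
    rwa [eigenvalue, ← algebraMap_eq, algebraMap_smul]

theorem linearIndependent_eigenFamily (x : Option ℂˣ) :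
    LinearIndependent ℂ[X] (eigenFamily x) := by
  have comp_eq_zero {p : ℂ[X]} (h : p.comp (-X) = 0) : p = 0 := by
    simpa [comp_assoc] using congrArg (fun q : ℂ[X] => q.comp (-X)) h
  rw [linearIndependent_iff']
  intro s p h
  have h' : ∀ i, ∑ k ∈ s, (p k).comp (-X) * seq i (eigenFamily x k) = 0 := fun i => by
    simpa [seq_smul] using congrArg (seq i) h
  intro i hi
  apply comp_eq_zero
  rcases x with _ | a
  · simpa [eigenFamily, seq_genDual, hi] using h' i
  -- After cancelling `a^n`, the relation at `L_n` says that `P`, a polynomial with coefficients in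
  -- `ℂ[λ]`, vanishes at `n`. It has infinitely many roots in a domain.
  · let P : ℂ[X][X] := ∑ k ∈ s, monomial k ((p k).comp (-X))
    have hP : P = 0 := by
      refine eq_zero_of_infinite_isRoot P (Set.infinite_of_injective_forall_mem
        (f := fun n : ℕ => (n : ℂ[X])) Nat.cast_injective fun n => ?_)
      have h1 := h' n
      simp only [eigenFamily, seq_fam, C_mul, mul_left_comm _ (C ((a : ℂ) ^ n)),
        ← Finset.mul_sum] at h1
      have h2 := (mul_eq_zero.1 h1).resolve_left (by simp)
      simpa [P, IsRoot.def, eval_finsetSum] using h2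
    have := congrArg (fun Q => Q.coeff i) hP
    simpa [P, finsetSum_coeff, coeff_monomial, hi] using this

/-- Each family with a fixed eigenvalue is independent and spans a submodule of one generalized
eigenspace of the shift; these eigenspaces are independent for distinct eigenvalues. -/
theorem linearIndependent_sumElim : LinearIndependent ℂ[X]
    (Sum.elim (fun x : ℂˣ × ℕ => fam x.1 x.2) genDual) := by
  have hspan : ∀ x, Submodule.span ℂ[X] (Set.range (eigenFamily x)) ≤
      shift.maxGenEigenspace (eigenvalue x) := fun x => Submodule.span_le.2 <| by
    rintro _ ⟨m, rfl⟩
    exact eigenFamily_mem x m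
  have hli : LinearIndependent ℂ[X] fun x : Σ _ : Option ℂˣ, ℕ => eigenFamily x.1 x.2 := by
    refine linearIndependent_iUnion_finite linearIndependent_eigenFamily fun x t _ hx => ?_
    refine ((shift.independent_maxGenEigenspace.comp eigenvalue_injective) x).mono (hspan x) ?_
    exact iSup₂_le fun y hy => (hspan y).trans <|
      le_iSup₂_of_le (f := fun y (_ : y ≠ x) => shift.maxGenEigenspace (eigenvalue y)) y
        (fun h => hx (h ▸ hy)) le_rfl
  let e : (ℂˣ × ℕ) ⊕ ℕ → Σ _ : Option ℂˣ, ℕ :=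
    Sum.elim (fun x => ⟨some x.1, x.2⟩) fun j => ⟨none, j⟩
  have he : Function.Injective e := by
    rintro (⟨a, m⟩ | j) (⟨b, n⟩ | k) h <;> simp_all [e]
  convert hli.comp e he using 1
  ext1 (_ | _) <;> rfl

theorem span_sumElim : Submodule.span ℂ[X] (Set.range
    (Sum.elim (fun x : ℂˣ × ℕ => fam x.1 x.2) genDual)) = V ⊔ U := by
  rw [Set.Sum.elim_range, Submodule.span_union, sup_comm, V, U]

theorem disjoint_V_U : Disjoint V U :=
  (linearIndependent_sum.1 linearIndependent_sumElim).2.2.symm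

end Witt

end

/-! ### The main theorem -/

theorem theorem5p6 :
    -- `U` is good, its coproduct is a differential Lie coalgebra structure with the stated
    -- values on generators; the span of `f_{a,0}, …, f_{a,m}` is a finite rank subcoalgebra
    (IsGood Witt.U ∧
      ∃ δ : Witt.U →ₗ[ℂ] Witt.U ⊗[ℂ] Witt.U,
        IsCoproductOf Witt.U δ ∧
        (∀ δ' : Witt.U →ₗ[ℂ] Witt.U ⊗[ℂ] Witt.U, IsCoproductOf Witt.U δ' → δ' = δ) ∧
        IsDifferentialLieCoalgebra δ ∧
        (∀ (a : ℂˣ) (m : ℕ), δ (Witt.famU a m) =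
          ∑ j ∈ Finset.range (m + 1), (m.choose j : ℂ) •
            (((X : ℂ[X]) • Witt.famU a j) ⊗ₜ[ℂ] Witt.famU a (m - j) -
              Witt.famU a j ⊗ₜ[ℂ] ((X : ℂ[X]) • Witt.famU a (m - j)))) ∧
        (∀ (a : ℂˣ) (m : ℕ),
          let N := Submodule.span ℂ[X] (Set.range fun j : Fin (m + 1) => Witt.famU a j)
          IsSubcoalgebra δ N ∧ IsFiniteRank N)) ∧
    -- the `f_{a,m}` and the `L_i^*` form a basis of the linearly conformal recursive sequences
    (LinearIndependent ℂ[X]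
        (Sum.elim (fun x : ℂˣ × ℕ => Witt.fam x.1 x.2) Witt.genDual) ∧
      (Submodule.span ℂ[X] (Set.range
        (Sum.elim (fun x : ℂˣ × ℕ => Witt.fam x.1 x.2) Witt.genDual)) :
          Set (ConformalDual Witt)) = {f | Witt.IsRecursive f}) ∧
    -- `L⁰ = V ⊕ U` is the space of linearly conformal recursive sequences
    (Disjoint Witt.V Witt.U ∧ upperZero Witt = Witt.V ⊔ Witt.U ∧
      (upperZero Witt : Set (ConformalDual Witt)) = {f | Witt.IsRecursive f}) ∧
    -- `L⁰` is a differential Lie coalgebra, `Loc(L⁰) = V ⊕ U = L⁰`, and it is locally finite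
    (∃ δ : upperZero Witt →ₗ[ℂ] upperZero Witt ⊗[ℂ] upperZero Witt,
      IsCoproductOf (upperZero Witt) δ ∧
      (∀ δ' : upperZero Witt →ₗ[ℂ] upperZero Witt ⊗[ℂ] upperZero Witt,
        IsCoproductOf (upperZero Witt) δ' → δ' = δ) ∧
      IsDifferentialLieCoalgebra δ ∧
      (Loc δ).map (upperZero Witt).subtype = Witt.V ⊔ Witt.U ∧
      Loc δ = ⊤ ∧
      IsLocallyFinite δ) := by
  have hrec : ((Witt.V ⊔ Witt.U : Submodule ℂ[X] (ConformalDual Witt)) :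
      Set (ConformalDual Witt)) = {f | Witt.IsRecursive f} := by
    rw [← Witt.recursive_eq]; rfl
  refine ⟨⟨Witt.isGood_U, ?_⟩, ⟨Witt.linearIndependent_sumElim, ?_⟩,
    ⟨Witt.disjoint_V_U, Witt.upperZero_eq, ?_⟩, ?_⟩
  · obtain ⟨δ, hδ⟩ := Witt.exists_isCoproductOf Witt.isGood_U
    refine ⟨δ, hδ, fun δ' h' => Witt.eq_of_isCoproductOf h' hδ,
      Witt.isDifferentialLieCoalgebra_of_isCoproductOf hδ, fun a m => ?_, fun a m => ⟨?_, ?_⟩⟩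
    · exact Witt.tensorIncl_injective _ <| (Witt.isCoproductOf_iff.1 hδ _).unique <|
        Witt.isCobracket_fam a m (Witt.famU a) fun _ _ => rfl
    · refine Witt.isSubcoalgebra_of_isGood hδ ?_
      rw [Submodule.map_span, ← Set.range_comp]
      exact Witt.isGood_famSpan a m
    · exact isFiniteRank_of_fg (Submodule.fg_span (Set.finite_range _))
  · rw [Witt.span_sumElim, hrec]
  · rw [Witt.upperZero_eq, hrec]
  · have hgood : IsGood (upperZero Witt) := by
      rw [Witt.upperZero_eq]
      exact Witt.isGood_sup Witt.isGood_V Witt.isGood_U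
    obtain ⟨δ, hδ⟩ := Witt.exists_isCoproductOf hgood
    have hfin : IsLocallyFinite δ := by
      rintro ⟨f, hf⟩
      obtain ⟨N, hN, hfg, hfN⟩ := Witt.exists_isGood_fg (Witt.upperZero_eq.le hf)
      -- A good `N` lies in `L⁰` by definition, so pulling it back to `L⁰` loses nothing.
      have hmap : (N.comap (upperZero Witt).subtype).map (upperZero Witt).subtype = N := by
        rw [Submodule.map_comap_subtype, inf_eq_right]
        exact le_sSup hN
      refine ⟨N.comap (upperZero Witt).subtype, Witt.isSubcoalgebra_of_isGood hδ (by rwa [hmap]),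
        isFiniteRank_of_fg ?_, hfN⟩
      refine Submodule.fg_of_fg_map_injective _ (upperZero Witt).subtype_injective ?_
      rwa [hmap]
    have hloc : Loc δ = ⊤ := eq_top_iff.2 fun f _ => by
      obtain ⟨N, h1, h2, h3⟩ := hfin f
      exact (le_sSup (show N ∈ {N | IsSubcoalgebra δ N ∧ IsFiniteRank N} from ⟨h1, h2⟩)) h3
    refine ⟨δ, hδ, fun δ' h' => Witt.eq_of_isCoproductOf h' hδ,
      Witt.isDifferentialLieCoalgebra_of_isCoproductOf hδ, ?_, hloc, hfin⟩
    rw [hloc, Submodule.map_subtype_top, Witt.upperZero_eq]
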